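/- Let $n\ge 1$, $s\in(0,1)$, and let $\Omega\subset\mathbb R^n$ be open and bounded. Let $G(t)=\int_0^t g(\tau)\,d\tau$ be a Young function, i.e. $g$ is right continuous on $[0,\infty)$, $g(0)=0$, $g(t)>0$ for $t>0$, $g$ is nondecreasing on $(0,\infty)$ and $g(t)\to\infty$ as $t\to\infty$; assume that for some constants $p^\pm$ $$1<p^-\le \frac{t g(t)}{G(t)}\le p^+<\infty\qquad\text{for all } t>0 .$$ Let $\beta\in L^\infty(\mathbb R^n\setminus\Omega)$ with $\beta>0$ a.e. Write $D_su(x,y)=\frac{u(x)-u(y)}{|x-y|^s}$, $d\nu=\frac{dx\,dy}{|x-y|^n}$, $\Omega_*=\mathbb R^{2n}\setminus(\Omega^c)^2$, and $$\Phi_{G,\Omega}(u)=\int_\Omega G(|u|)\,dx,\qquad \mathcal E_S(u,v)=\iint_S g(|D_su|)\frac{D_su}{|D_su|}D_sv\,d\nu ,\qquad b_u(v)=\int_\Omega g(|u|)\frac{u}{|u|}v\,dx$$ (the integrands are read as $0$ where $D_su=0$, respectively $u=0$). Consider the spaces of (classes of) measurable functions * $W^{s,G}_0(\Omega)$: $u$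 on $\mathbb R^n$ with $\int_{\mathbb R^n}G(|u|)\,dx<\infty$, $\iint_{\mathbb R^{2n}}G(|D_su|)\,d\nu<\infty$ and $u=0$ a.e. in $\mathbb R^n\setminus\Omega$; * $W^{s,G}_*(\Omega)$: $u$ on $\mathbb R^n$ with $\Phi_{G,\Omega}(u)<\infty$ and $\iint_{\Omega_*}G(|D_su|)\,d\nu<\infty$; * $W^{s,G}_{reg}(\Omega)$: $u$ on $\Omega$ with $\Phi_{G,\Omega}(u)<\infty$ and $\iint_{\Omega\times\Omega}G(|D_su|)\,d\nu<\infty$; * $\mathcal X$: $u$ on $\mathbb R^n$ with $\iint_{\Omega_*}G(|D_su|)\,d\nu+\Phi_{G,\Omega}(u)+\int_{\mathbb R^n\setminus\Omega}\beta G(|u|)\,dx<\infty$. A real number $\lambda$ is called an eigenvalue with eigenfunction $u$ of * the Dirichlet problem if $u\in W^{s,G}_0(\Omega)$ and $\mathcal E_{\mathbb R^{2n}}(u,v)=(\lambda-1)\,b_u(v)$ for all $v\in W^{s,G}_0(\Omega)$; * the Neumann problem if $u\in W^{s,G}_*(\Omega)$ and $\frac12\mathcal E_{\Omega_*}(u,v)=(\lambda-1)\,b_u(v)$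 for all $v\in W^{s,G}_*(\Omega)$; * the regional Neumann problem if $u\in W^{s,G}_{reg}(\Omega)$ and $\mathcal E_{\Omega\times\Omega}(u,v)=(\lambda-1)\,b_u(v)$ for all $v\in W^{s,G}_{reg}(\Omega)$; * the Robin problem if $u\in\mathcal X$ and $\frac12\mathcal E_{\Omega_*}(u,v)=(\lambda-1)\,b_u(v)-\int_{\mathbb R^n\setminus\Omega}\beta g(|u|)\frac{u}{|u|}v\,dx$ for all $v\in\mathcal X$. **Theorem.** There is a constant $c>0$, independent of $\mu$ (it may depend on $n,s,g,p^\pm,\Omega,\beta$), such that for every $\mu>0$ the following holds: whenever $\lambda_D$, $\lambda_R$, $\lambda_N$, $\lambda_{\tilde N}$ are eigenvalues of the Dirichlet, Robin, Neumann and regional Neumann problem, respectively, with eigenfunctions $u_D,u_R,u_N,u_{\tilde N}$ normalized by $\Phi_{G,\Omega}(u_D)=\Phi_{G,\Omega}(u_R)=\Phi_{G,\Omega}(u_N)=\Phi_{G,\Omega}(u_{\tilde N})=\mu$, then $\lambda_D\ge c$, $\lambda_R\ge c$, $\lambda_N\ge c$ and $\lambda_{\tilde N}\ge c$. -/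

import Mathlib

open MeasureTheory Set Filter Topology

noncomputable section

namespace FracOrlicz

/-- `g` is the density of a Young function: right continuous on `[0,∞)`, `g 0 = 0`, positive and
nondecreasing on `(0,∞)`, tending to `∞` at `∞`. Values of `g` at negative arguments are never
used. -/
structure IsYoungDensity (g : ℝ → ℝ) : Prop where
  rightCont : ∀ t : ℝ, 0 ≤ t → ContinuousWithinAt g (Ici t) t
  zero : g 0 = 0
  pos : ∀ t : ℝ, 0 < t → 0 < g t
  mono : MonotoneOn g (Ioi 0)
  atTop : Tendsto g atTop atTop

/-- The Young function `G t = ∫_0^t g`. -/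
def youngFun (g : ℝ → ℝ) (t : ℝ) : ℝ := ∫ τ in (0 : ℝ)..t, g τ

/-- `1 < p⁻ ≤ t g(t) / G(t) ≤ p⁺ < ∞` for all `t > 0`. -/
def GrowthCondition (g : ℝ → ℝ) (pm pp : ℝ) : Prop :=
  1 < pm ∧ ∀ t : ℝ, 0 < t → pm ≤ t * g t / youngFun g t ∧ t * g t / youngFun g t ≤ pp

/-- The odd extension `t ↦ g(|t|) t / |t|` (equal to `0` at `t = 0`). -/
def oddExt (g : ℝ → ℝ) (t : ℝ) : ℝ := g |t| * (t / |t|)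

variable {n : ℕ}

/-- The measure `dx dy / |x - y|^n` on `ℝⁿ × ℝⁿ`. -/
def singMeasure (n : ℕ) : Measure (EuclideanSpace ℝ (Fin n) × EuclideanSpace ℝ (Fin n)) :=
  (volume.prod volume).withDensity fun z => ENNReal.ofReal (1 / ‖z.1 - z.2‖ ^ n)

/-- The `s`-Hölder quotient `(u(x) - u(y)) / |x - y|^s`. -/
def holderQuot (s : ℝ) (u : EuclideanSpace ℝ (Fin n) → ℝ)
    (z : EuclideanSpace ℝ (Fin n) × EuclideanSpace ℝ (Fin n)) : ℝ :=
  (u z.1 - u z.2) / ‖z.1 - z.2‖ ^ s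

/-- `ℝ²ⁿ \ (Ωᶜ)²`. -/
def crossSet (Ω : Set (EuclideanSpace ℝ (Fin n))) :
    Set (EuclideanSpace ℝ (Fin n) × EuclideanSpace ℝ (Fin n)) :=
  (Ωᶜ ×ˢ Ωᶜ)ᶜ

/-- The modular `Φ_{G,Ω}(u) = ∫_Ω G(|u|) dx`, with values in `[0,∞]`. -/
def modular (g : ℝ → ℝ) (Ω : Set (EuclideanSpace ℝ (Fin n)))
    (u : EuclideanSpace ℝ (Fin n) → ℝ) : ENNReal :=
  ∫⁻ x in Ω, ENNReal.ofReal (youngFun g |u x|)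

/-- The modular `Φ_{G,β,Ωᶜ}(u) = ∫_{ℝⁿ\Ω} β G(|u|) dx`. -/
def modularExt (g : ℝ → ℝ) (β : EuclideanSpace ℝ (Fin n) → ℝ)
    (Ω : Set (EuclideanSpace ℝ (Fin n))) (u : EuclideanSpace ℝ (Fin n) → ℝ) : ENNReal :=
  ∫⁻ x in Ωᶜ, ENNReal.ofReal (β x * youngFun g |u x|)

/-- The fractional modular `∬_S G(|D_s u|) dx dy / |x - y|^n` over `S ⊆ ℝⁿ × ℝⁿ`; the cases
used are `S = ℝⁿ × ℝⁿ`, `S = Ω × Ω` and `S = ℝ²ⁿ \ (Ωᶜ)²`. -/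
def fracModular (g : ℝ → ℝ) (s : ℝ)
    (S : Set (EuclideanSpace ℝ (Fin n) × EuclideanSpace ℝ (Fin n)))
    (u : EuclideanSpace ℝ (Fin n) → ℝ) : ENNReal :=
  ∫⁻ z in S, ENNReal.ofReal (youngFun g |holderQuot s u z|) ∂(singMeasure n)

/-- `L^G(Ω)`, as a set of functions on `ℝⁿ` of which only the values on `Ω` matter. -/
def LG (g : ℝ → ℝ) (Ω : Set (EuclideanSpace ℝ (Fin n))) :
    Set (EuclideanSpace ℝ (Fin n) → ℝ) :=
  {u | AEMeasurable u (volume.restrict Ω) ∧ modular g Ω u < ⊤}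

/-- `W^{s,G}_reg(Ω)`; only the values of `u` on `Ω` matter. -/
def WReg (g : ℝ → ℝ) (s : ℝ) (Ω : Set (EuclideanSpace ℝ (Fin n))) :
    Set (EuclideanSpace ℝ (Fin n) → ℝ) :=
  {u | u ∈ LG g Ω ∧ fracModular g s (Ω ×ˢ Ω) u < ⊤}

/-- `W^{s,G}_0(Ω)`: functions in `W^{s,G}(ℝⁿ)` vanishing a.e. outside `Ω`. -/
def WZero (g : ℝ → ℝ) (s : ℝ) (Ω : Set (EuclideanSpace ℝ (Fin n))) :
    Set (EuclideanSpace ℝ (Fin n) → ℝ) :=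
  {u | u ∈ LG g univ ∧ fracModular g s univ u < ⊤ ∧ ∀ᵐ x ∂(volume.restrict Ωᶜ), u x = 0}

/-- `W^{s,G}_*(Ω)`: measurable functions on `ℝⁿ`, in `L^G(Ω)`, with finite modular over
`ℝ²ⁿ \ (Ωᶜ)²`. -/
def WStar (g : ℝ → ℝ) (s : ℝ) (Ω : Set (EuclideanSpace ℝ (Fin n))) :
    Set (EuclideanSpace ℝ (Fin n) → ℝ) :=
  {u | AEMeasurable u volume ∧ u ∈ LG g Ω ∧ fracModular g s (crossSet Ω) u < ⊤}

/-- The space `𝒳` of the Robin problem. -/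
def XSpace (g : ℝ → ℝ) (s : ℝ) (β : EuclideanSpace ℝ (Fin n) → ℝ)
    (Ω : Set (EuclideanSpace ℝ (Fin n))) : Set (EuclideanSpace ℝ (Fin n) → ℝ) :=
  {u | AEMeasurable u volume ∧
    fracModular g s (crossSet Ω) u + modular g Ω u + modularExt g β Ω u < ⊤}

/-- The form `∬_S g(|D_s u|) (D_s u / |D_s u|) D_s v dx dy / |x - y|^n`. -/
def fracForm (g : ℝ → ℝ) (s : ℝ)
    (S : Set (EuclideanSpace ℝ (Fin n) × EuclideanSpace ℝ (Fin n)))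
    (u v : EuclideanSpace ℝ (Fin n) → ℝ) : ℝ :=
  ∫ z in S, oddExt g (holderQuot s u z) * holderQuot s v z ∂(singMeasure n)

/-- `⟨(-Δ_g)^s u, v⟩`. -/
def pairing (g : ℝ → ℝ) (s : ℝ) (u v : EuclideanSpace ℝ (Fin n) → ℝ) : ℝ :=
  fracForm g s univ u v

/-- `⟨(-Δ_g)^s_Ω u, v⟩`, the pairing of the regional operator. -/
def pairingReg (g : ℝ → ℝ) (s : ℝ) (Ω : Set (EuclideanSpace ℝ (Fin n)))
    (u v : EuclideanSpace ℝ (Fin n) → ℝ) : ℝ :=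
  fracForm g s (Ω ×ˢ Ω) u v

/-- `⟨(-Δ_g)^s u, v⟩_*`. -/
def pairingStar (g : ℝ → ℝ) (s : ℝ) (Ω : Set (EuclideanSpace ℝ (Fin n)))
    (u v : EuclideanSpace ℝ (Fin n) → ℝ) : ℝ :=
  1 / 2 * fracForm g s (crossSet Ω) u v

/-- `lam` is an eigenvalue of the Dirichlet problem with eigenfunction `u`. (Non-triviality of `u`
is not part of this definition; it is enforced by a normalization `Φ_{G,Ω}(u) = μ > 0`. The same
applies to the three definitions below.) -/
def IsDirichletEigen (g : ℝ → ℝ) (s : ℝ) (Ω : Set (EuclideanSpace ℝ (Fin n)))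
    (lam : ℝ) (u : EuclideanSpace ℝ (Fin n) → ℝ) : Prop :=
  u ∈ WZero g s Ω ∧ ∀ v ∈ WZero g s Ω,
    pairing g s u v = (lam - 1) * ∫ x in Ω, oddExt g (u x) * v x

/-- `lam` is an eigenvalue of the Neumann problem with eigenfunction `u`. -/
def IsNeumannEigen (g : ℝ → ℝ) (s : ℝ) (Ω : Set (EuclideanSpace ℝ (Fin n)))
    (lam : ℝ) (u : EuclideanSpace ℝ (Fin n) → ℝ) : Prop :=
  u ∈ WStar g s Ω ∧ ∀ v ∈ WStar g s Ω,
    pairingStar g s Ω u v = (lam - 1) * ∫ x in Ω, oddExt g (u x) * v x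

/-- `lam` is an eigenvalue of the regional Neumann problem with eigenfunction `u`. -/
def IsRegionalNeumannEigen (g : ℝ → ℝ) (s : ℝ) (Ω : Set (EuclideanSpace ℝ (Fin n)))
    (lam : ℝ) (u : EuclideanSpace ℝ (Fin n) → ℝ) : Prop :=
  u ∈ WReg g s Ω ∧ ∀ v ∈ WReg g s Ω,
    pairingReg g s Ω u v = (lam - 1) * ∫ x in Ω, oddExt g (u x) * v x

/-- `lam` is an eigenvalue of the Robin problem with eigenfunction `u`. -/
def IsRobinEigen (g : ℝ → ℝ) (s : ℝ) (β : EuclideanSpace ℝ (Fin n) → ℝ)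
    (Ω : Set (EuclideanSpace ℝ (Fin n))) (lam : ℝ) (u : EuclideanSpace ℝ (Fin n) → ℝ) : Prop :=
  u ∈ XSpace g s β Ω ∧ ∀ v ∈ XSpace g s β Ω,
    pairingStar g s Ω u v =
      (lam - 1) * (∫ x in Ω, oddExt g (u x) * v x) - ∫ x in Ωᶜ, β x * oddExt g (u x) * v x

end FracOrlicz

end

namespace FracOrlicz

/-! Each equation is tested with its own eigenfunction, `v = u`. Since `oddExt g t * t = g |t| * |t|
≥ 0`, the nonlocal form is nonnegative on the diagonal, and so is the Robin term because `β > 0`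
a.e. Hence `(λ - 1) b_u(u) ≥ 0`. As `b_u(u) > 0` (`integral_oddExt_mul_self_pos`), this forces `λ ≥
1`, so `c = 1` serves all four problems and every `μ`. The delicate point is the strict positivity
of `b_u(u)`: a Bochner integral is `0` when the integrand is not integrable, so finiteness must come
from the upper growth bound `t g(t) ≤ p⁺ G(t)`. -/

lemma IsYoungDensity.measurable_comp_abs {g : ℝ → ℝ} (hg : IsYoungDensity g) :
    Measurable fun t : ℝ => g |t| := by
  -- `g` is arbitrary on negative arguments; truncating at `0` gives a function monotone on all of
  -- `ℝ`, hence Borel.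
  have hmono : Monotone fun t : ℝ => g (max t 0) := by
    intro a b hab
    rcases le_or_gt b 0 with hb | hb
    · simp [max_eq_right hb, max_eq_right (hab.trans hb)]
    rcases le_or_gt a 0 with ha | ha
    · simpa [max_eq_right ha, max_eq_left hb.le, hg.zero] using (hg.pos b hb).le
    · simpa [max_eq_left ha.le, max_eq_left hb.le] using hg.mono ha hb hab
  have h := hmono.measurable.comp (measurable_norm (α := ℝ))
  simpa [Function.comp_def] using h

lemma IsYoungDensity.nonneg {g : ℝ → ℝ} (hg : IsYoungDensity g) {t : ℝ} (ht : 0 ≤ t) :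
    0 ≤ g t := by
  rcases ht.eq_or_lt with rfl | h
  · exact hg.zero.ge
  · exact (hg.pos t h).le

lemma oddExt_mul_self (g : ℝ → ℝ) (t : ℝ) : oddExt g t * t = g |t| * |t| := by
  rcases eq_or_ne t 0 with rfl | ht
  · simp
  · have h : |t| ≠ 0 := abs_ne_zero.mpr ht
    unfold oddExt
    field_simp
    rw [sq_abs]

lemma IsYoungDensity.oddExt_mul_self_nonneg {g : ℝ → ℝ} (hg : IsYoungDensity g) (t : ℝ) :
    0 ≤ oddExt g t * t := by
  rw [oddExt_mul_self]
  exact mul_nonneg (hg.nonneg (abs_nonneg t)) (abs_nonneg t)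

/-- The lower growth bound makes the quotient `t g(t) / G(t)` positive, and its numerator is
positive. No integrability of `g` is needed. -/
lemma GrowthCondition.youngFun_pos {g : ℝ → ℝ} {pm pp : ℝ} (hG : GrowthCondition g pm pp)
    (hg : IsYoungDensity g) {t : ℝ} (ht : 0 < t) : 0 < youngFun g t := by
  have h : 0 < t * g t / youngFun g t := (zero_lt_one.trans hG.1).trans_le (hG.2 t ht).1
  exact (div_pos_iff_of_pos_left (mul_pos ht (hg.pos t ht))).mp h

lemma GrowthCondition.oddExt_mul_self_le {g : ℝ → ℝ} {pm pp : ℝ} (hG : GrowthCondition g pm pp)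
    (hg : IsYoungDensity g) (t : ℝ) : oddExt g t * t ≤ pp * youngFun g |t| := by
  rw [oddExt_mul_self]
  rcases eq_or_ne t 0 with rfl | ht
  · simp [youngFun]
  · have h := abs_pos.mpr ht
    rw [mul_comm]
    exact (div_le_iff₀ (hG.youngFun_pos hg h)).mp (hG.2 _ h).2

lemma GrowthCondition.exponent_pos {g : ℝ → ℝ} {pm pp : ℝ} (hG : GrowthCondition g pm pp) :
    0 < pp :=
  (zero_lt_one.trans hG.1).trans_le ((hG.2 1 one_pos).1.trans (hG.2 1 one_pos).2)

variable {n : ℕ}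

/-- `b_u(u)` is positive as soon as the modular of `u` is positive and finite. -/
lemma integral_oddExt_mul_self_pos {g : ℝ → ℝ} (hg : IsYoungDensity g) {pm pp : ℝ}
    (hG : GrowthCondition g pm pp) {Ω : Set (EuclideanSpace ℝ (Fin n))}
    {u : EuclideanSpace ℝ (Fin n) → ℝ} (hu : AEMeasurable u (volume.restrict Ω))
    (h0 : modular g Ω u ≠ 0) (hfin : modular g Ω u ≠ ⊤) :
    0 < ∫ x in Ω, oddExt g (u x) * u x := by
  have hmeas : AEStronglyMeasurable (fun x => oddExt g (u x) * u x) (volume.restrict Ω) := by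
    simp_rw [oddExt_mul_self]
    exact ((hg.measurable_comp_abs.mul measurable_norm).comp_aemeasurable hu).aestronglyMeasurable
  have hnonneg : 0 ≤ fun x => oddExt g (u x) * u x := fun x => hg.oddExt_mul_self_nonneg _
  -- The integrand is dominated by `p⁺ G(|u|)`, whose integral is `p⁺` times the finite modular.
  have hint : Integrable (fun x => oddExt g (u x) * u x) (volume.restrict Ω) := by
    refine ⟨hmeas, ?_⟩
    rw [hasFiniteIntegral_iff_ofReal (Eventually.of_forall hnonneg)]
    calc ∫⁻ x in Ω, ENNReal.ofReal (oddExt g (u x) * u x)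
        ≤ ∫⁻ x in Ω, ENNReal.ofReal pp * ENNReal.ofReal (youngFun g |u x|) := by
          refine lintegral_mono fun x => ?_
          rw [← ENNReal.ofReal_mul hG.exponent_pos.le]
          exact ENNReal.ofReal_le_ofReal (hG.oddExt_mul_self_le hg _)
      _ = ENNReal.ofReal pp * modular g Ω u :=
          lintegral_const_mul' _ _ ENNReal.ofReal_ne_top
      _ < ⊤ := ENNReal.mul_lt_top ENNReal.ofReal_lt_top hfin.lt_top
  -- A vanishing integral would give `g(|u|)|u| = 0`, so `u = 0` a.e. on `Ω` and the modular would
  -- be `0`.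
  refine (integral_nonneg hnonneg).lt_of_ne' fun h => h0 ?_
  rw [integral_eq_zero_iff_of_nonneg hnonneg hint] at h
  unfold modular
  rw [← lintegral_zero (μ := volume.restrict Ω)]
  refine lintegral_congr_ae (h.mono fun x hx => ?_)
  have hux : u x = 0 := by
    by_contra hne
    have hpos := abs_pos.mpr hne
    simp only [oddExt_mul_self, Pi.zero_apply] at hx
    exact (mul_pos (hg.pos _ hpos) hpos).ne' hx
  simp [hux, youngFun]

/-- Pointwise nonnegativity suffices: the default value `0` for a non-integrable integrand is
harmless here. -/
lemma fracForm_self_nonneg {g : ℝ → ℝ} (hg : IsYoungDensity g) (s : ℝ)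
    (S : Set (EuclideanSpace ℝ (Fin n) × EuclideanSpace ℝ (Fin n)))
    (u : EuclideanSpace ℝ (Fin n) → ℝ) : 0 ≤ fracForm g s S u u :=
  integral_nonneg fun _ => hg.oddExt_mul_self_nonneg _

lemma one_le_of_nonneg_sub_one_mul {lam b : ℝ} (hb : 0 < b) (h : 0 ≤ (lam - 1) * b) :
    1 ≤ lam :=
  sub_nonneg.mp (nonneg_of_mul_nonneg_left h hb)

end FracOrlicz

theorem mainTheorem8 (n : ℕ) (hn : 1 ≤ n) (s : ℝ) (hs0 : 0 < s) (hs1 : s < 1)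
    (g : ℝ → ℝ) (hg : FracOrlicz.IsYoungDensity g)
    (pm pp : ℝ) (hG : FracOrlicz.GrowthCondition g pm pp)
    (Ω : Set (EuclideanSpace ℝ (Fin n))) (hΩo : IsOpen Ω) (hΩb : Bornology.IsBounded Ω)
    (β : EuclideanSpace ℝ (Fin n) → ℝ)
    (hβ : MemLp β ⊤ (volume.restrict Ωᶜ))
    (hβpos : ∀ᵐ x ∂(volume.restrict Ωᶜ), 0 < β x) :
    ∃ c : ℝ, 0 < c ∧ ∀ μ : ℝ, 0 < μ →
      (∀ (lamD : ℝ) (u : EuclideanSpace ℝ (Fin n) → ℝ),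
        FracOrlicz.IsDirichletEigen g s Ω lamD u →
        FracOrlicz.modular g Ω u = ENNReal.ofReal μ → c ≤ lamD) ∧
      (∀ (lamR : ℝ) (u : EuclideanSpace ℝ (Fin n) → ℝ),
        FracOrlicz.IsRobinEigen g s β Ω lamR u →
        FracOrlicz.modular g Ω u = ENNReal.ofReal μ → c ≤ lamR) ∧
      (∀ (lamN : ℝ) (u : EuclideanSpace ℝ (Fin n) → ℝ),
        FracOrlicz.IsNeumannEigen g s Ω lamN u →
        FracOrlicz.modular g Ω u = ENNReal.ofReal μ → c ≤ lamN) ∧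
      (∀ (lamRegN : ℝ) (u : EuclideanSpace ℝ (Fin n) → ℝ),
        FracOrlicz.IsRegionalNeumannEigen g s Ω lamRegN u →
        FracOrlicz.modular g Ω u = ENNReal.ofReal μ → c ≤ lamRegN) := by
  refine ⟨1, one_pos, fun μ hμ => ?_⟩
  have key : ∀ u : EuclideanSpace ℝ (Fin n) → ℝ, AEMeasurable u (volume.restrict Ω) →
      FracOrlicz.modular g Ω u = ENNReal.ofReal μ →
      0 < ∫ x in Ω, FracOrlicz.oddExt g (u x) * u x := fun u hu hm =>
    FracOrlicz.integral_oddExt_mul_self_pos hg hG hu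
      (hm ▸ (ENNReal.ofReal_pos.mpr hμ).ne') (hm ▸ ENNReal.ofReal_ne_top)
  refine ⟨fun lam u h hm => ?_, fun lam u h hm => ?_, fun lam u h hm => ?_, fun lam u h hm => ?_⟩
  · have hu : AEMeasurable u (volume.restrict Ω) :=
      h.1.1.1.mono_measure (Measure.restrict_mono (subset_univ Ω) le_rfl)
    refine FracOrlicz.one_le_of_nonneg_sub_one_mul (key u hu hm) ?_
    rw [← h.2 u h.1]
    exact FracOrlicz.fracForm_self_nonneg hg s _ u
  · refine FracOrlicz.one_le_of_nonneg_sub_one_mul (key u h.1.1.restrict hm) ?_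
    -- The Robin term enters the equation with a minus sign; moved to the side of the form, it only
    -- helps.
    have hext : 0 ≤ ∫ x in Ωᶜ, β x * FracOrlicz.oddExt g (u x) * u x := by
      refine integral_nonneg_of_ae (hβpos.mono fun x hx => ?_)
      simp only [Pi.zero_apply, mul_assoc]
      exact mul_nonneg hx.le (hg.oddExt_mul_self_nonneg _)
    have hform : 0 ≤ FracOrlicz.pairingStar g s Ω u u :=
      mul_nonneg (by norm_num) (FracOrlicz.fracForm_self_nonneg hg s _ u)
    linarith [h.2 u h.1]
  · refine FracOrlicz.one_le_of_nonneg_sub_one_mul (key u h.1.1.restrict hm) ?_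
    rw [← h.2 u h.1]
    exact mul_nonneg (by norm_num) (FracOrlicz.fracForm_self_nonneg hg s _ u)
  · refine FracOrlicz.one_le_of_nonneg_sub_one_mul (key u h.1.1.1 hm) ?_
    rw [← h.2 u h.1]
    exact FracOrlicz.fracForm_self_nonneg hg s _ u
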